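/- Let $r\ge 0$ and let $\mathcal G=(V,E)$ be a finite connected undirected (simple) graph with $n$ nodes, $m$ edges and oriented incidence matrix $B$ (for an arbitrary orientation of the edges). Let $M_i\succ 0$, $R_i\succcurlyeq 0$ ($i\in V$) and $W_k\succ 0$ ($k\in E$) be real symmetric $r\times r$ matrices and let $v\in\mathbb R^{rn}$ be a constant vector. Put $M=\mathrm{diag}(M_i)$, $R=\mathrm{diag}(R_i)$, $W=\mathrm{diag}(W_k)$, $\mathbb B=B\otimes I_r$, $\mathbb L=\mathbb B W\mathbb B^T$, and consider the mass-spring-damper system $$\dot p=-RM^{-1}p-\mathbb B W q+v,\qquad \dot q=\mathbb B^T M^{-1}p,\qquad y=M^{-1}p\qquad (t\ge 0).$$ A node $i$ is damped if $R_i\succ 0$ and (partially) undamped otherwise; let $V_d$ and $V_u$ be the sets of damped and of (partially) undamped nodes, and assume that $V_d\neq\emptyset$. Write $M_u=\mathrm{diag}(M_i)_{i\in V_u}$ and $R_u=\mathrm{diag}(R_i)_{i\in V_u}$. Let $E^d$, $E^u$, $E^i$ be the sets of edges between two nodes of $V_d$, between two nodes of $V_u$, and between a node of $V_d$ and a node of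 $V_u$, with weight matrices $W^d,W^u,W^i$, and partition $\mathbb B$ accordingly: $$\mathbb B=\begin{pmatrix}\mathbb B_d^d&\mathbb B_d^i&0\\0&\mathbb B_u^i&\mathbb B_u^u\end{pmatrix}.$$ Put $\mathbb L_d^d=\mathbb B_d^dW^d(\mathbb B_d^d)^T$, $\mathbb L_u^u=\mathbb B_u^uW^u(\mathbb B_u^u)^T$, $\mathbb L_d^i=\mathbb B_d^iW^i(\mathbb B_d^i)^T$, $\mathbb L_u^i=\mathbb B_u^iW^i(\mathbb B_u^i)^T$, $\mathbb L_i^i=\mathbb B_d^iW^i(\mathbb B_u^i)^T$, and let $$\tilde{\mathbb L}_u=(\mathbb L_u^u+\mathbb L_u^i)-(\mathbb L_i^i)^T(\mathbb L_d^d+\mathbb L_d^i)^{-1}\mathbb L_i^i$$ be the Kron-reduced Laplacian (the empty matrix if $V_u=\emptyset$). Then the following are equivalent. (i) Every output trajectory $y(t)$ of the system converges, as $t\to\infty$, to a point of $\mathrm{im}(\mathbb 1\otimes I_r)$, where $\mathbb 1\in\mathbb R^n$ is the all-ones vector. (ii) No (real) eigenvector of $M_u^{-1}\tilde{\mathbb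 L}_u$ lies in $\ker\mathbb L_i^i\cap\ker R_u$. (iii) Every (real) eigenvector of $M^{-1}\mathbb L$ that lies in $\ker R$ has at least one nonzero entry that corresponds to a damped node. -/

import Mathlib

open scoped Matrix Kronecker Topology

/-- A mass-spring-damper network with `r`-dimensional masses and springs and with all its parameters:
a connected undirected graph, an (arbitrary) orientation of its edges, inertia matrices `M i ≻ 0` and
damping matrices `R i ≽ 0` of the nodes, weight matrices `W k ≻ 0` of the edges, a constant external
input `v`, and at least one damped node, that is, one node with `R i ≻ 0`. -/
structure MSDNetwork (V : Type*) (r : ℕ) where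
  /-- the underlying undirected graph -/
  graph : SimpleGraph V
  connected : graph.Connected
  /-- the tail of an edge in the chosen orientation -/
  tail : graph.edgeSet → V
  /-- the head of an edge in the chosen orientation -/
  head : graph.edgeSet → V
  ends : ∀ k : graph.edgeSet, s(tail k, head k) = (k : Sym2 V)
  /-- inertia matrices -/
  M : V → Matrix (Fin r) (Fin r) ℝ
  /-- damping matrices -/
  R : V → Matrix (Fin r) (Fin r) ℝ
  /-- edge weight matrices (spring constants) -/
  W : graph.edgeSet → Matrix (Fin r) (Fin r) ℝ
  /-- constant external input -/
  v : V × Fin r → ℝ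
  posDef_M : ∀ i, (M i).PosDef
  posSemidef_R : ∀ i, (R i).PosSemidef
  posDef_W : ∀ k, (W k).PosDef
  exists_damped : ∃ i, (R i).PosDef

namespace MSDNetwork

/-- The block diagonal matrix `diag(A i)` with rows and columns grouped by `i`. -/
def blockDiag {ι : Type*} [DecidableEq ι] {r : ℕ} (A : ι → Matrix (Fin r) (Fin r) ℝ) :
    Matrix (ι × Fin r) (ι × Fin r) ℝ :=
  (Matrix.blockDiagonal A).submatrix Prod.swap Prod.swap

/-- The matrix `𝟙 ⊗ I_r`: applied to `β`, it gives the stacked vector with all blocks equal to `β`. -/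
def syncMatrix (V : Type*) (r : ℕ) : Matrix (V × Fin r) (Fin r) ℝ :=
  Matrix.of fun i a => if i.2 = a then 1 else 0

variable {V : Type*} [Fintype V] [DecidableEq V] {r : ℕ} (N : MSDNetwork V r)

/-- The edge set `E` of the network. -/
abbrev Edge : Type _ := N.graph.edgeSet

noncomputable instance : Fintype N.Edge := Fintype.ofFinite _

/-- A node is damped if its damping matrix is positive definite. The other nodes are the
(partially) undamped ones. -/
def Damped (i : V) : Prop := (N.R i).PosDef

noncomputable instance : DecidablePred N.Damped := Classical.decPred _

/-- The set `V_d` of damped nodes. -/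
abbrev Vd : Type _ := {i : V // N.Damped i}

/-- The set `V_u` of (partially) undamped nodes. -/
abbrev Vu : Type _ := {i : V // ¬ N.Damped i}

/-- The edges between two damped nodes. -/
abbrev Ed : Type _ := {k : N.Edge // N.Damped (N.tail k) ∧ N.Damped (N.head k)}

/-- The edges between two (partially) undamped nodes. -/
abbrev Eu : Type _ := {k : N.Edge // ¬ N.Damped (N.tail k) ∧ ¬ N.Damped (N.head k)}

/-- The interconnecting edges, between a damped and a (partially) undamped node. -/
abbrev Ei : Type _ := {k : N.Edge // ¬ (N.Damped (N.tail k) ↔ N.Damped (N.head k))}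

/-- The (oriented) incidence matrix of the graph. -/
def incidence : Matrix V N.Edge ℝ :=
  Matrix.of fun i k => (if i = N.head k then 1 else 0) - (if i = N.tail k then 1 else 0)

/-- The total incidence matrix `𝔹 = B ⊗ I_r`. -/
def BB : Matrix (V × Fin r) (N.Edge × Fin r) ℝ :=
  N.incidence ⊗ₖ (1 : Matrix (Fin r) (Fin r) ℝ)

/-- `M = diag(M_1, …, M_n)`. -/
def MM : Matrix (V × Fin r) (V × Fin r) ℝ := blockDiag N.M

/-- `R = diag(R_1, …, R_n)`. -/
def RR : Matrix (V × Fin r) (V × Fin r) ℝ := blockDiag N.R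

/-- `W = diag(W_1, …, W_m)`. -/
def WW : Matrix (N.Edge × Fin r) (N.Edge × Fin r) ℝ := blockDiag N.W

/-- The total Laplacian matrix `𝕃 = 𝔹 W 𝔹ᵀ`. -/
noncomputable def LL : Matrix (V × Fin r) (V × Fin r) ℝ := N.BB * N.WW * N.BBᵀ

/-- The inertia matrix `M_u` of the undamped nodes. -/
def Mu : Matrix (N.Vu × Fin r) (N.Vu × Fin r) ℝ := blockDiag fun i => N.M i

/-- The damping matrix `R_u` of the undamped nodes. -/
def Ru : Matrix (N.Vu × Fin r) (N.Vu × Fin r) ℝ := blockDiag fun i => N.R i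

/-- The block of `𝔹` with rows in the damped nodes, columns in the edges between damped nodes. -/
def Bdd : Matrix (N.Vd × Fin r) (N.Ed × Fin r) ℝ :=
  N.incidence.submatrix (fun i => i.1) (fun k => k.1) ⊗ₖ (1 : Matrix (Fin r) (Fin r) ℝ)

/-- The block of `𝔹` with rows in the damped nodes, columns in the interconnecting edges. -/
def Bdi : Matrix (N.Vd × Fin r) (N.Ei × Fin r) ℝ :=
  N.incidence.submatrix (fun i => i.1) (fun k => k.1) ⊗ₖ (1 : Matrix (Fin r) (Fin r) ℝ)

/-- The block of `𝔹` with rows in the undamped nodes, columns in the interconnecting edges. -/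
def Bui : Matrix (N.Vu × Fin r) (N.Ei × Fin r) ℝ :=
  N.incidence.submatrix (fun i => i.1) (fun k => k.1) ⊗ₖ (1 : Matrix (Fin r) (Fin r) ℝ)

/-- The block of `𝔹` with rows in the undamped nodes, columns in the edges between them. -/
def Buu : Matrix (N.Vu × Fin r) (N.Eu × Fin r) ℝ :=
  N.incidence.submatrix (fun i => i.1) (fun k => k.1) ⊗ₖ (1 : Matrix (Fin r) (Fin r) ℝ)

/-- The weight matrix of the edges between damped nodes. -/
def Wd : Matrix (N.Ed × Fin r) (N.Ed × Fin r) ℝ := blockDiag fun k => N.W k.1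

/-- The weight matrix of the interconnecting edges. -/
def Wi : Matrix (N.Ei × Fin r) (N.Ei × Fin r) ℝ := blockDiag fun k => N.W k.1

/-- The weight matrix of the edges between undamped nodes. -/
def Wu : Matrix (N.Eu × Fin r) (N.Eu × Fin r) ℝ := blockDiag fun k => N.W k.1

/-- `𝕃_d^d`, the Laplacian matrix of the subgraph of the damped nodes. -/
noncomputable def Ldd : Matrix (N.Vd × Fin r) (N.Vd × Fin r) ℝ := N.Bdd * N.Wd * N.Bddᵀ

/-- `𝕃_d^i`, the damped diagonal block of the Laplacian matrix of the interconnecting edges. -/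
noncomputable def Ldi : Matrix (N.Vd × Fin r) (N.Vd × Fin r) ℝ := N.Bdi * N.Wi * N.Bdiᵀ

/-- `𝕃_i^i`, the damped-undamped block of the Laplacian matrix of the interconnecting edges. -/
noncomputable def Lii : Matrix (N.Vd × Fin r) (N.Vu × Fin r) ℝ := N.Bdi * N.Wi * N.Buiᵀ

/-- `𝕃_u^i`, the undamped diagonal block of the Laplacian matrix of the interconnecting edges. -/
noncomputable def Lui : Matrix (N.Vu × Fin r) (N.Vu × Fin r) ℝ := N.Bui * N.Wi * N.Buiᵀ

/-- `𝕃_u^u`, the Laplacian matrix of the subgraph of the undamped nodes. -/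
noncomputable def Luu : Matrix (N.Vu × Fin r) (N.Vu × Fin r) ℝ := N.Buu * N.Wu * N.Buuᵀ

/-- The Kron-reduced Laplacian
`𝕃̃_u = (𝕃_u^u + 𝕃_u^i) - (𝕃_i^i)ᵀ (𝕃_d^d + 𝕃_d^i)⁻¹ 𝕃_i^i`. When there is an undamped node, the
inverted matrix is positive definite; when there is none, `𝕃̃_u` is the empty matrix. -/
noncomputable def kronReduced : Matrix (N.Vu × Fin r) (N.Vu × Fin r) ℝ :=
  (N.Luu + N.Lui) - N.Liiᵀ * (N.Ldd + N.Ldi)⁻¹ * N.Lii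

/-- The state trajectories `(p, q)` on `[0, ∞)` of the closed-loop system
`ṗ = -R M⁻¹ p - 𝔹 W q + v`, `q̇ = 𝔹ᵀ M⁻¹ p`. -/
structure IsTrajectory (p : ℝ → V × Fin r → ℝ) (q : ℝ → N.Edge × Fin r → ℝ) : Prop where
  deriv_p : ∀ t, 0 ≤ t → HasDerivWithinAt p
    (-((N.RR * N.MM⁻¹) *ᵥ p t) - (N.BB * N.WW) *ᵥ q t + N.v) (Set.Ici 0) t
  deriv_q : ∀ t, 0 ≤ t → HasDerivWithinAt q ((N.BBᵀ * N.MM⁻¹) *ᵥ p t) (Set.Ici 0) t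

/-- `y` is an output trajectory `y = M⁻¹ p` of the closed-loop system. -/
def IsOutputTrajectory (y : ℝ → V × Fin r → ℝ) : Prop :=
  ∃ p q, N.IsTrajectory p q ∧ ∀ t, y t = N.MM⁻¹ *ᵥ p t

end MSDNetwork

/-!
Shifting by an equilibrium with synchronized velocities (`MSDNetwork.exists_equilibrium`) turns the
convergence of the outputs into the convergence `p → 0` for the system without external input. The
total energy of that system decreases at the rate of the dissipation `yᵀ R y`, so by LaSalle's
invariance principle (`tendsto_zero_of_energy_constant`) it is enough to exclude that `R y` vanishes
along a whole orbit with `y(0) ≠ 0`. On such an orbit the dampers are inactive, `ÿ = -M⁻¹ 𝕃 y`, and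
repeated differentiation gives `R (M⁻¹ 𝕃)ᵏ y = 0` for all `k`. Since `M⁻¹ 𝕃` is symmetric for the
inner product of `M`, the largest `M⁻¹ 𝕃`-invariant subspace of `ker R` then contains an eigenvector
(`exists_hasEigenvector_of_forall_pow`). Conversely, an eigenvector `x` in `ker R` has a positive
eigenvalue `ω²`, because there is a damped node and the graph is connected, and `cos(ωt) x` is an
oscillation that no damper sees (`MSDNetwork.isOutputTrajectory_oscillation`). Hence the outputs
converge if and only if no eigenvector of `M⁻¹ 𝕃` lies in `ker R`.

A vector in `ker R` vanishes at the damped nodes, where `R_i` is positive definite. So the condition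
on the eigenvectors of `M⁻¹ 𝕃` in `ker R` says that there are none, and every candidate is supported
on the undamped nodes. For such vectors the damped rows of the eigenvalue equation read
`𝕃_i^i x_u = 0`, which kills the Schur complement term of `𝕃̃_u`, and the undamped rows become the
eigenvalue equation of `M_u⁻¹ 𝕃̃_u` (`MSDNetwork.hasEigenvector_iff_kronReduced`).
-/

/-! ### Linear flows and LaSalle's principle -/

/-- A function that is positive off the origin and homogeneous of degree two on a finite-dimensional
space dominates a multiple of the squared norm, because it attains a positive minimum on the unit
sphere. -/
theorem exists_pos_mul_norm_sq_le {E : Type*} [NormedAddCommGroup E] [NormedSpace ℝ E]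
    [FiniteDimensional ℝ E] {H : E → ℝ} (hH : Continuous H) (hpos : ∀ x, x ≠ 0 → 0 < H x)
    (hsmul : ∀ (c : ℝ) x, H (c • x) = c ^ 2 * H x) :
    ∃ c > 0, ∀ x, c * ‖x‖ ^ 2 ≤ H x := by
  have hzero : H 0 = 0 := by simpa using hsmul 0 0
  rcases subsingleton_or_nontrivial E with hE | hE
  · refine ⟨1, one_pos, fun x => ?_⟩
    simp [Subsingleton.elim x 0, hzero]
  obtain ⟨u, hu, hmin⟩ := (isCompact_sphere (0 : E) 1).exists_isMinOn
    (NormedSpace.sphere_nonempty.2 zero_le_one) hH.continuousOn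
  have hu0 : u ≠ 0 := by
    rintro rfl
    simp at hu
  refine ⟨H u, hpos u hu0, fun x => ?_⟩
  rcases eq_or_ne x 0 with rfl | hx
  · simp [hzero]
  have hx' : 0 < ‖x‖ := norm_pos_iff.2 hx
  have hmem : ‖x‖⁻¹ • x ∈ Metric.sphere (0 : E) 1 := by
    simp [norm_smul, hx'.ne']
  have hle : H u ≤ H (‖x‖⁻¹ • x) := hmin hmem
  rw [hsmul] at hle
  calc H u * ‖x‖ ^ 2 ≤ (‖x‖⁻¹ ^ 2 * H x) * ‖x‖ ^ 2 := by gcongr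
    _ = H x := by field_simp

/-- The time-`t` map of the flow of `ẋ = A x`, that is, `x ↦ exp(tA) x`. -/
noncomputable def linearFlow {E : Type*} [NormedAddCommGroup E] [NormedSpace ℝ E]
    (A : E →L[ℝ] E) (t : ℝ) (x : E) : E :=
  NormedSpace.exp (t • A) x

section linearFlow

variable {E : Type*} [NormedAddCommGroup E] [NormedSpace ℝ E] [CompleteSpace E] (A : E →L[ℝ] E)

omit [CompleteSpace E] in
theorem linearFlow_zero (x : E) : linearFlow A 0 x = x := by
  simp [linearFlow]

theorem hasDerivAt_linearFlow (t : ℝ) (x : E) :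
    HasDerivAt (fun s => linearFlow A s x) (A (linearFlow A t x)) t := by
  have h := hasDerivAt_exp_smul_const' (𝕂 := ℝ) A t
  exact h.clm_apply (hasDerivAt_const t x) |>.congr_deriv (by simp [linearFlow])

theorem linearFlow_add (s t : ℝ) (x : E) :
    linearFlow A (s + t) x = linearFlow A s (linearFlow A t x) := by
  have hc : Commute (s • A) (t • A) := ((Commute.refl A).smul_left s).smul_right t
  let _ : NormedAlgebra ℚ (E →L[ℝ] E) := NormedAlgebra.restrictScalars ℚ ℝ _
  simp [linearFlow, add_smul, NormedSpace.exp_add_of_commute hc]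

/-- A solution on `[0, ∞)` of a linear differential equation is an orbit of its flow. -/
theorem eq_linearFlow_of_hasDerivWithinAt {x : ℝ → E}
    (hx : ∀ t, 0 ≤ t → HasDerivWithinAt x (A (x t)) (Set.Ici 0) t) {t : ℝ} (ht : 0 ≤ t) :
    x t = linearFlow A t (x 0) := by
  refine ODE_solution_unique (f := x) (g := fun s => linearFlow A s (x 0)) (v := fun _ => A)
    (K := ‖A‖₊) (a := 0) (b := t)
    (fun _ => A.lipschitz) ?_ ?_ ?_ ?_ ?_ ⟨ht, le_rfl⟩
  · exact fun s hs => (hx s hs.1).continuousWithinAt.mono Set.Icc_subset_Ici_self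
  · exact fun s hs => (hx s hs.1).mono (Set.Ici_subset_Ici.2 hs.1)
  · exact fun s _ => (hasDerivAt_linearFlow A s _).continuousAt.continuousWithinAt
  · exact fun s _ => (hasDerivAt_linearFlow A s _).hasDerivWithinAt
  · simp [linearFlow_zero]

/-- LaSalle's invariance principle for a linear flow and a proper energy: a continuous quantity that
vanishes at every point along whose forward orbit the energy is constant tends to zero along every
orbit. -/
theorem tendsto_zero_of_energy_constant [ProperSpace E] {F : Type*} [TopologicalSpace F] [Zero F]
    {H : E → ℝ} (hH : Continuous H)
    {c : ℝ} (hc : 0 < c) (hcoer : ∀ x, c * ‖x‖ ^ 2 ≤ H x)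
    (hanti : ∀ x, Antitone fun t => H (linearFlow A t x))
    {C : E → F} (hC : Continuous C)
    (hzero : ∀ z, (∀ s, 0 ≤ s → H (linearFlow A s z) = H z) → C z = 0) (x : E) :
    Filter.Tendsto (fun t => C (linearFlow A t x)) Filter.atTop (𝓝 0) := by
  have hbdd : BddBelow (Set.range fun t => H (linearFlow A t x)) :=
    ⟨0, by rintro _ ⟨t, rfl⟩; exact le_trans (by positivity) (hcoer _)⟩
  have hlim := tendsto_atTop_ciInf (hanti x) hbdd
  set l := ⨅ t, H (linearFlow A t x)
  -- The forward orbit stays in a ball, so it converges along every ultrafilter finer than `atTop`.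
  have hball : ∀ t, 0 ≤ t → linearFlow A t x ∈ Metric.closedBall (0 : E) √(H x / c) := by
    intro t ht
    have h1 : H (linearFlow A t x) ≤ H x := by
      simpa [linearFlow_zero] using hanti x ht
    rw [mem_closedBall_zero_iff]
    refine Real.le_sqrt_of_sq_le ((le_div_iff₀ hc).2 ?_)
    linarith [hcoer (linearFlow A t x)]
  refine (Filter.tendsto_iff_ultrafilter _ _ _).2 fun f hf => ?_
  obtain ⟨z, -, hz⟩ := (isCompact_closedBall (0 : E) √(H x / c)).ultrafilter_le_nhds
    (f.map fun t => linearFlow A t x) (by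
      rw [Filter.le_principal_iff]
      exact Filter.mem_map.2 (hf (Filter.mem_atTop_sets.2 ⟨0, hball⟩)))
  have hz' : Filter.Tendsto (fun t => linearFlow A t x) f (𝓝 z) := hz
  -- The energy along the orbit of the limit point is the limit of the energy of the given orbit.
  have hconst : ∀ s, H (linearFlow A s z) = l := by
    intro s
    have hcont : Continuous fun w => H (linearFlow A s w) :=
      hH.comp (NormedSpace.exp (s • A)).continuous
    have h1 := (hcont.tendsto z).comp hz'
    have h2 : Filter.Tendsto (fun t => H (linearFlow A (s + t) x)) f (𝓝 l) :=
      (hlim.comp (Filter.tendsto_atTop_add_const_left _ s Filter.tendsto_id)).mono_left hf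
    refine tendsto_nhds_unique h1 (h2.congr fun t => ?_)
    simp [linearFlow_add]
  have hCz : C z = 0 := hzero z fun s _ => by
    rw [hconst, ← hconst 0, linearFlow_zero]
  rw [← hCz]
  exact (hC.tendsto z).comp hz'

/-- If a linear observation of an orbit vanishes for all nonnegative times, so does the same
observation of its velocity. -/
theorem clm_apply_generator_eq_zero {F : Type*} [NormedAddCommGroup F] [NormedSpace ℝ F]
    (K : E →L[ℝ] F) {z : E} (h : ∀ s, 0 ≤ s → K (linearFlow A s z) = 0) {s : ℝ} (hs : 0 ≤ s) :
    K (A (linearFlow A s z)) = 0 := by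
  have h1 : HasDerivWithinAt (fun t => K (linearFlow A t z)) (K (A (linearFlow A s z)))
      (Set.Ici 0) s :=
    (K.hasFDerivAt.comp_hasDerivAt s (hasDerivAt_linearFlow A s z)).hasDerivWithinAt
  have h2 : HasDerivWithinAt (fun t => K (linearFlow A t z)) 0 (Set.Ici 0) s :=
    (hasDerivWithinAt_const s (Set.Ici 0) (0 : F)).congr (fun t ht => h t ht) (h s hs)
  exact (uniqueDiffOn_Ici 0 s hs).eq_deriv _ h1 h2

end linearFlow

/-! ### Definite matrices and symmetric pencils -/

section Definite

variable {n : Type*} [Fintype n] {S : Matrix n n ℝ}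

theorem Matrix.PosDef.dotProduct_mulVec_eq_zero (hS : S.PosDef) {x : n → ℝ}
    (hx : x ⬝ᵥ S *ᵥ x = 0) : x = 0 := by
  by_contra h
  exact (hS.dotProduct_mulVec_pos h).ne' hx

theorem Matrix.IsHermitian.dotProduct_mulVec_comm (hS : S.IsHermitian) (x y : n → ℝ) :
    x ⬝ᵥ S *ᵥ y = S *ᵥ x ⬝ᵥ y := by
  have hT : Sᵀ = S := by simpa using hS.eq
  rw [Matrix.dotProduct_mulVec, ← Matrix.mulVec_transpose, hT]

theorem Matrix.PosDef.mul_inv_cancel [DecidableEq n] (hS : S.PosDef) : S * S⁻¹ = 1 :=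
  Matrix.mul_nonsing_inv _ ((Matrix.isUnit_iff_isUnit_det _).1 hS.isUnit)

theorem Matrix.PosDef.inv_mul_cancel [DecidableEq n] (hS : S.PosDef) : S⁻¹ * S = 1 :=
  Matrix.nonsing_inv_mul _ ((Matrix.isUnit_iff_isUnit_det _).1 hS.isUnit)

theorem Matrix.PosDef.inv_mulVec_eq_iff [DecidableEq n] (hS : S.PosDef) {x y : n → ℝ} :
    S⁻¹ *ᵥ x = y ↔ x = S *ᵥ y := by
  constructor <;> rintro rfl
  · simp [Matrix.mulVec_mulVec, hS.mul_inv_cancel]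
  · simp [Matrix.mulVec_mulVec, hS.inv_mul_cancel]

theorem HasDerivAt.dotProduct_mulVec_self (hS : S.IsHermitian) {u : ℝ → n → ℝ} {u' : n → ℝ}
    {t : ℝ} (hu : HasDerivAt u u' t) :
    HasDerivAt (fun s => u s ⬝ᵥ S *ᵥ u s) (2 * (S *ᵥ u t ⬝ᵥ u')) t := by
  have hi := hasDerivAt_pi.1 hu
  have hSu : ∀ i, HasDerivAt (fun s => (S *ᵥ u s) i) ((S *ᵥ u') i) t := by
    intro i
    simp only [Matrix.mulVec, dotProduct]
    exact HasDerivAt.fun_sum fun j _ => (hi j).const_mul _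
  have h : HasDerivAt (fun s => u s ⬝ᵥ S *ᵥ u s)
      (∑ i, (u' i * (S *ᵥ u t) i + u t i * (S *ᵥ u') i)) t :=
    HasDerivAt.fun_sum fun i _ => (hi i).mul (hSu i)
  refine h.congr_deriv ?_
  rw [Finset.sum_add_distrib]
  change u' ⬝ᵥ S *ᵥ u t + u t ⬝ᵥ S *ᵥ u' = _
  rw [hS.dotProduct_mulVec_comm (u t), dotProduct_comm u']
  ring

/-- An invariant subspace of an operator that is symmetric for some inner product contains an
eigenvector, unless it is zero. -/
theorem exists_hasEigenvector_mem_of_symmetric {F : Type*} [AddCommGroup F] [Module ℝ F]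
    [FiniteDimensional ℝ F] (core : InnerProductSpace.Core ℝ F) {T : Module.End ℝ F}
    (hT : ∀ u w, core.inner (T u) w = core.inner u (T w)) {U : Submodule ℝ F}
    (hinv : ∀ w ∈ U, T w ∈ U) (hne : U ≠ ⊥) :
    ∃ (μ : ℝ) (x : F), x ∈ U ∧ Module.End.HasEigenvector T μ x := by
  let _ : NormedAddCommGroup F := core.toNormedAddCommGroup
  let _ : InnerProductSpace ℝ F := InnerProductSpace.ofCore core.toCore
  have hsymm : T.IsSymmetric := hT
  by_contra! hcon
  have hsub : Subsingleton U := by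
    refine (hsymm.restrict_invariant hinv).subsingleton_of_no_eigenvalue_finiteDimensional ?_
    intro μ
    rw [Submodule.eq_bot_iff]
    intro w hw
    by_contra hw0
    refine hcon μ w w.2 ⟨?_, fun h0 => hw0 (Subtype.ext h0)⟩
    rw [Module.End.mem_eigenspace_iff] at hw ⊢
    exact congrArg Subtype.val hw
  exact hne ((Submodule.subsingleton_iff_eq_bot).1 hsub)

/-- The pencil of a symmetric matrix `L` and a positive definite matrix `M` satisfies the
eigenvector test for observability: if the whole orbit of a nonzero vector under `M⁻¹ L` lies in the
kernel of `R`, so does an eigenvector of `M⁻¹ L`. Indeed `M⁻¹ L` is symmetric for the inner product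
of `M`, so it has an eigenvector in its largest invariant subspace inside `ker R`. -/
theorem exists_hasEigenvector_of_forall_pow [DecidableEq n] {M L R : Matrix n n ℝ} (hM : M.PosDef)
    (hL : L.IsHermitian) {y : n → ℝ} (hy : y ≠ 0)
    (h : ∀ k : ℕ, R *ᵥ ((M⁻¹ * L) ^ k) *ᵥ y = 0) :
    ∃ (μ : ℝ) (x : n → ℝ),
      Module.End.HasEigenvector (Matrix.toLin' (M⁻¹ * L)) μ x ∧ R *ᵥ x = 0 := by
  let core : InnerProductSpace.Core ℝ (n → ℝ) :=
    { inner := fun u w => u ⬝ᵥ M *ᵥ w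
      conj_inner_symm := fun u w => by
        rw [conj_trivial, hM.isHermitian.dotProduct_mulVec_comm, dotProduct_comm]
      re_inner_nonneg := fun u => by
        simpa using hM.posSemidef.dotProduct_mulVec_nonneg u
      add_left := fun u w x => add_dotProduct _ _ _
      smul_left := fun u w c => by simp
      definite := fun u hu => hM.dotProduct_mulVec_eq_zero hu }
  have hsymm : ∀ u w, core.inner (Matrix.toLin' (M⁻¹ * L) u) w =
      core.inner u (Matrix.toLin' (M⁻¹ * L) w) := by
    intro u w
    change (M⁻¹ * L) *ᵥ u ⬝ᵥ M *ᵥ w = u ⬝ᵥ M *ᵥ (M⁻¹ * L) *ᵥ w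
    rw [hM.isHermitian.dotProduct_mulVec_comm, Matrix.mulVec_mulVec, Matrix.mulVec_mulVec,
      ← Matrix.mul_assoc, hM.mul_inv_cancel, Matrix.one_mul, hL.dotProduct_mulVec_comm]
  let U : Submodule ℝ (n → ℝ) := ⨅ k : ℕ, LinearMap.ker (R * (M⁻¹ * L) ^ k).mulVecLin
  have hU : ∀ w, w ∈ U ↔ ∀ k : ℕ, R *ᵥ ((M⁻¹ * L) ^ k) *ᵥ w = 0 := by
    simp [U, Submodule.mem_iInf]
  have hinv : ∀ w ∈ U, Matrix.toLin' (M⁻¹ * L) w ∈ U := by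
    intro w hw
    rw [hU] at hw ⊢
    intro k
    have := hw (k + 1)
    rwa [pow_succ, ← Matrix.mulVec_mulVec] at this
  obtain ⟨μ, x, hxU, hx⟩ := exists_hasEigenvector_mem_of_symmetric core hsymm hinv
    fun hbot => hy (by simpa [hbot] using (hU y).2 h)
  exact ⟨μ, x, hx, by simpa using (hU x).1 hxU 0⟩

end Definite

/-! ### Mass-spring-damper systems without input -/

section DampedSystem

variable {n m : Type*} [Fintype n] [DecidableEq n] [Fintype m]
  (M R : Matrix n n ℝ) (W : Matrix m m ℝ) (B : Matrix n m ℝ)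

/-- The generator `(p, q) ↦ (-R M⁻¹ p - B W q, Bᵀ M⁻¹ p)` of a mass-spring-damper system without
external input. -/
noncomputable def dampedGenerator : (n → ℝ) × (m → ℝ) →L[ℝ] (n → ℝ) × (m → ℝ) :=
  LinearMap.toContinuousLinearMap
    ((-((R * M⁻¹).mulVecLin ∘ₗ LinearMap.fst ℝ _ _) - (B * W).mulVecLin ∘ₗ LinearMap.snd ℝ _ _).prod
      ((Bᵀ * M⁻¹).mulVecLin ∘ₗ LinearMap.fst ℝ _ _))

theorem dampedGenerator_apply (z : (n → ℝ) × (m → ℝ)) :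
    dampedGenerator M R W B z =
      (-((R * M⁻¹) *ᵥ z.1) - (B * W) *ᵥ z.2, (Bᵀ * M⁻¹) *ᵥ z.1) := rfl

/-- Twice the total energy (kinetic and elastic) of a mass-spring-damper system. -/
noncomputable def totalEnergy (z : (n → ℝ) × (m → ℝ)) : ℝ :=
  z.1 ⬝ᵥ M⁻¹ *ᵥ z.1 + z.2 ⬝ᵥ W *ᵥ z.2

theorem continuous_totalEnergy : Continuous (totalEnergy M W) := by
  unfold totalEnergy
  fun_prop

variable {M R W}

theorem totalEnergy_pos (hM : M.PosDef) (hW : W.PosDef) {z : (n → ℝ) × (m → ℝ)} (hz : z ≠ 0) :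
    0 < totalEnergy M W z := by
  have h1 := hM.inv.posSemidef.dotProduct_mulVec_nonneg z.1
  have h2 := hW.posSemidef.dotProduct_mulVec_nonneg z.2
  simp only [star_trivial] at h1 h2
  refine (add_nonneg h1 h2).lt_of_ne fun h0 => hz (Prod.ext ?_ ?_)
  · exact hM.inv.dotProduct_mulVec_eq_zero (by linarith)
  · exact hW.dotProduct_mulVec_eq_zero (by linarith)

theorem totalEnergy_smul (c : ℝ) (z : (n → ℝ) × (m → ℝ)) :
    totalEnergy M W (c • z) = c ^ 2 * totalEnergy M W z := by
  simp only [totalEnergy, Prod.smul_fst, Prod.smul_snd, Matrix.mulVec_smul, smul_dotProduct,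
    dotProduct_smul, smul_eq_mul]
  ring

/-- Energy balance: only the dampers dissipate energy. -/
theorem hasDerivAt_totalEnergy (hM : M.PosDef) (hW : W.PosDef) (z : (n → ℝ) × (m → ℝ)) (t : ℝ) :
    HasDerivAt (fun s => totalEnergy M W (linearFlow (dampedGenerator M R W B) s z))
      (-2 * ((M⁻¹ *ᵥ (linearFlow (dampedGenerator M R W B) t z).1) ⬝ᵥ
        R *ᵥ M⁻¹ *ᵥ (linearFlow (dampedGenerator M R W B) t z).1)) t := by
  have h := hasDerivAt_linearFlow (dampedGenerator M R W B) t z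
  set x := fun s => linearFlow (dampedGenerator M R W B) s z
  rw [dampedGenerator_apply] at h
  have h1 := h.hasFDerivAt.fst.hasDerivAt.dotProduct_mulVec_self hM.inv.isHermitian
  have h2 := h.hasFDerivAt.snd.hasDerivAt.dotProduct_mulVec_self hW.isHermitian
  refine (h1.add h2).congr_deriv ?_
  change 2 * (M⁻¹ *ᵥ (x t).1 ⬝ᵥ ((1 : ℝ) • (-((R * M⁻¹) *ᵥ (x t).1) - (B * W) *ᵥ (x t).2))) +
    2 * (W *ᵥ (x t).2 ⬝ᵥ ((1 : ℝ) • ((Bᵀ * M⁻¹) *ᵥ (x t).1))) =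
    -2 * ((M⁻¹ *ᵥ (x t).1) ⬝ᵥ R *ᵥ M⁻¹ *ᵥ (x t).1)
  have h3 : M⁻¹ *ᵥ (x t).1 ⬝ᵥ (B * W) *ᵥ (x t).2 = W *ᵥ (x t).2 ⬝ᵥ (Bᵀ * M⁻¹) *ᵥ (x t).1 := by
    rw [← Matrix.mulVec_mulVec, ← Matrix.mulVec_mulVec, Matrix.dotProduct_mulVec,
      ← Matrix.mulVec_transpose, dotProduct_comm]
  rw [one_smul, one_smul, dotProduct_sub, h3, dotProduct_neg, ← Matrix.mulVec_mulVec]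
  ring

/-- Along an orbit of constant energy the damping force vanishes. Differentiating this twice, again
and again, shows that the orbit of the velocity under `M⁻¹ B W Bᵀ` stays in the kernel of `R`. -/
theorem damping_pow_eq_zero_of_energy_constant (hM : M.PosDef) (hR : R.PosSemidef) (hW : W.PosDef)
    {z : (n → ℝ) × (m → ℝ)}
    (hz : ∀ s, 0 ≤ s → totalEnergy M W (linearFlow (dampedGenerator M R W B) s z) =
      totalEnergy M W z) (k : ℕ) {s : ℝ} (hs : 0 ≤ s) :
    R *ᵥ ((M⁻¹ * (B * W * Bᵀ)) ^ k) *ᵥ M⁻¹ *ᵥ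
      (linearFlow (dampedGenerator M R W B) s z).1 = 0 := by
  have hbase : ∀ s, 0 ≤ s →
      R *ᵥ M⁻¹ *ᵥ (linearFlow (dampedGenerator M R W B) s z).1 = 0 := by
    intro s hs
    have h1 := (hasDerivAt_totalEnergy (R := R) B hM hW z s).hasDerivWithinAt (s := Set.Ici 0)
    have h2 := (hasDerivWithinAt_const s (Set.Ici 0) (totalEnergy M W z)).congr
      (fun t ht => hz t ht) (hz s hs)
    have h3 := (uniqueDiffOn_Ici 0 s hs).eq_deriv _ h1 h2
    refine (hR.dotProduct_mulVec_zero_iff _).1 ?_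
    rw [star_trivial]
    linarith
  induction k generalizing s with
  | zero => simpa using hbase s hs
  | succ k ih =>
    -- The velocity of `M⁻¹ p` is `-M⁻¹ B W q` because `R M⁻¹ p = 0`, and that of `q` is `Bᵀ M⁻¹ p`.
    let K₁ : (n → ℝ) × (m → ℝ) →L[ℝ] (n → ℝ) := LinearMap.toContinuousLinearMap
      ((R * (M⁻¹ * (B * W * Bᵀ)) ^ k * M⁻¹).mulVecLin ∘ₗ LinearMap.fst ℝ _ _)
    let K₂ : (n → ℝ) × (m → ℝ) →L[ℝ] (n → ℝ) := LinearMap.toContinuousLinearMap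
      ((R * (M⁻¹ * (B * W * Bᵀ)) ^ k * M⁻¹ * (B * W)).mulVecLin ∘ₗ LinearMap.snd ℝ _ _)
    have hK₁ : ∀ w, K₁ w = (R * (M⁻¹ * (B * W * Bᵀ)) ^ k * M⁻¹) *ᵥ w.1 := fun _ => rfl
    have hK₂ : ∀ w, K₂ w = (R * (M⁻¹ * (B * W * Bᵀ)) ^ k * M⁻¹ * (B * W)) *ᵥ w.2 := fun _ => rfl
    have h1 : ∀ s, 0 ≤ s → K₂ (linearFlow (dampedGenerator M R W B) s z) = 0 := by
      intro s hs
      have h := clm_apply_generator_eq_zero (dampedGenerator M R W B) K₁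
        (fun s hs => by simpa [hK₁, Matrix.mulVec_mulVec, Matrix.mul_assoc] using ih hs) hs
      rw [hK₁, dampedGenerator_apply, ← Matrix.mulVec_mulVec _ R, hbase s hs, neg_zero, zero_sub,
        Matrix.mulVec_neg, neg_eq_zero, Matrix.mulVec_mulVec] at h
      exact h
    have h2 := clm_apply_generator_eq_zero (dampedGenerator M R W B) K₂ h1 hs
    rw [hK₂, dampedGenerator_apply] at h2
    simpa [Matrix.mulVec_mulVec, Matrix.mul_assoc, pow_succ] using h2

/-- If no eigenvector of `M⁻¹ B W Bᵀ` lies in the kernel of `R`, then the momenta of every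
trajectory of the system without input tend to zero. -/
theorem tendsto_momentum_zero (hM : M.PosDef) (hR : R.PosSemidef) (hW : W.PosDef)
    (hobs : ∀ (μ : ℝ) (x : n → ℝ),
      Module.End.HasEigenvector (Matrix.toLin' (M⁻¹ * (B * W * Bᵀ))) μ x → R *ᵥ x ≠ 0)
    {p : ℝ → n → ℝ} {q : ℝ → m → ℝ}
    (hp : ∀ t, 0 ≤ t →
      HasDerivWithinAt p (-((R * M⁻¹) *ᵥ p t) - (B * W) *ᵥ q t) (Set.Ici 0) t)
    (hq : ∀ t, 0 ≤ t → HasDerivWithinAt q ((Bᵀ * M⁻¹) *ᵥ p t) (Set.Ici 0) t) :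
    Filter.Tendsto p Filter.atTop (𝓝 0) := by
  have hflow : ∀ t, 0 ≤ t →
      (p t, q t) = linearFlow (dampedGenerator M R W B) t (p 0, q 0) := fun t ht =>
    eq_linearFlow_of_hasDerivWithinAt (dampedGenerator M R W B) (x := fun t => (p t, q t))
      (fun t ht => (hp t ht).prodMk (hq t ht)) ht
  obtain ⟨c, hc, hcoer⟩ := exists_pos_mul_norm_sq_le (continuous_totalEnergy M W)
    (fun _ => totalEnergy_pos hM hW) totalEnergy_smul
  have hanti : ∀ z, Antitone fun t =>
      totalEnergy M W (linearFlow (dampedGenerator M R W B) t z) := fun z =>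
    antitone_of_hasDerivAt_nonpos (hasDerivAt_totalEnergy B hM hW z) fun t => by
      have := hR.dotProduct_mulVec_nonneg
        (M⁻¹ *ᵥ (linearFlow (dampedGenerator M R W B) t z).1)
      rw [star_trivial] at this
      simpa using this
  have hL : (B * W * Bᵀ).IsHermitian := by
    simpa using Matrix.isHermitian_mul_mul_conjTranspose B hW.isHermitian
  refine (tendsto_zero_of_energy_constant (dampedGenerator M R W B) (continuous_totalEnergy M W)
    hc hcoer hanti continuous_fst (fun z hz => ?_) (p 0, q 0)).congr' ?_
  · by_contra hne
    obtain ⟨μ, x, hx, hRx⟩ := exists_hasEigenvector_of_forall_pow (R := R) (y := M⁻¹ *ᵥ z.1) hM hL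
      (fun h0 => hne (by simpa using hM.inv_mulVec_eq_iff.1 h0)) fun k => by
        simpa [linearFlow_zero] using
          damping_pow_eq_zero_of_energy_constant B hM hR hW hz k le_rfl
    exact hobs μ x hx hRx
  · filter_upwards [Filter.eventually_ge_atTop 0] with t ht
    rw [← hflow t ht]

end DampedSystem

/-! ### Block matrices and the network Laplacian -/

theorem Matrix.PosDef.hasEigenvector_inv_mul_iff {n : Type*} [Fintype n] [DecidableEq n]
    {M L : Matrix n n ℝ} (hM : M.PosDef) {μ : ℝ} {x : n → ℝ} :
    Module.End.HasEigenvector (Matrix.toLin' (M⁻¹ * L)) μ x ↔ L *ᵥ x = μ • M *ᵥ x ∧ x ≠ 0 := by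
  rw [Module.End.hasEigenvector_iff, Module.End.mem_eigenspace_iff, Matrix.toLin'_apply,
    ← Matrix.mulVec_mulVec, hM.inv_mulVec_eq_iff, Matrix.mulVec_smul]

/-- A function that is constant along the edges of a connected graph is constant. -/
theorem SimpleGraph.Connected.eq_of_forall_adj {V α : Type*} {G : SimpleGraph V}
    (hG : G.Connected) {f : V → α} (hf : ∀ i j, G.Adj i j → f i = f j) (i j : V) : f i = f j := by
  obtain ⟨w⟩ := hG.preconnected i j
  induction w with
  | nil => rfl
  | cons h _ ih => exact (hf _ _ h).trans ih

namespace MSDNetwork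

section BlockDiag

variable {ι : Type*} [Fintype ι] [DecidableEq ι] {r : ℕ} {A : ι → Matrix (Fin r) (Fin r) ℝ}

theorem blockDiag_mulVec_apply (A : ι → Matrix (Fin r) (Fin r) ℝ) (x : ι × Fin r → ℝ) (i : ι)
    (a : Fin r) : (blockDiag A *ᵥ x) (i, a) = (A i *ᵥ fun b => x (i, b)) a := by
  simp [blockDiag, Matrix.mulVec, dotProduct, Fintype.sum_prod_type, Matrix.blockDiagonal_apply,
    ite_mul, Finset.sum_ite_eq]

theorem dotProduct_blockDiag_mulVec (A : ι → Matrix (Fin r) (Fin r) ℝ) (x : ι × Fin r → ℝ) :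
    x ⬝ᵥ blockDiag A *ᵥ x = ∑ i, (fun b => x (i, b)) ⬝ᵥ A i *ᵥ fun b => x (i, b) := by
  simp only [dotProduct, Fintype.sum_prod_type, blockDiag_mulVec_apply]

omit [Fintype ι] in
theorem isHermitian_blockDiag (hA : ∀ i, (A i).IsHermitian) : (blockDiag A).IsHermitian :=
  (Matrix.isHermitian_blockDiagonal_iff.2 hA).submatrix _

theorem posSemidef_blockDiag (hA : ∀ i, (A i).PosSemidef) : (blockDiag A).PosSemidef := by
  refine .of_dotProduct_mulVec_nonneg (isHermitian_blockDiag fun i => (hA i).isHermitian)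
    fun x => ?_
  rw [star_trivial, dotProduct_blockDiag_mulVec]
  exact Finset.sum_nonneg fun i _ => by
    simpa using (hA i).dotProduct_mulVec_nonneg fun b => x (i, b)

theorem posDef_blockDiag (hA : ∀ i, (A i).PosDef) : (blockDiag A).PosDef := by
  refine .of_dotProduct_mulVec_pos (isHermitian_blockDiag fun i => (hA i).isHermitian)
    fun x hx => ?_
  rw [star_trivial, dotProduct_blockDiag_mulVec]
  obtain ⟨⟨i, a⟩, hia⟩ := Function.ne_iff.1 hx
  refine Finset.sum_pos' (fun j _ => ?_) ⟨i, Finset.mem_univ i, ?_⟩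
  · simpa using (hA j).posSemidef.dotProduct_mulVec_nonneg fun b => x (j, b)
  · have hne : (fun b => x (i, b)) ≠ 0 := fun h => hia (congrFun h a)
    simpa using (hA i).dotProduct_mulVec_pos hne

end BlockDiag

variable {V : Type*} [Fintype V] [DecidableEq V] {r : ℕ} (N : MSDNetwork V r)

omit [Fintype V] [DecidableEq V] in
theorem syncMatrix_mulVec_apply (β : Fin r → ℝ) (i : V × Fin r) :
    (syncMatrix V r *ᵥ β) i = β i.2 := by
  simp [syncMatrix, Matrix.mulVec, dotProduct]

theorem posDef_MM : N.MM.PosDef := posDef_blockDiag N.posDef_M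

theorem posDef_WW : N.WW.PosDef := posDef_blockDiag N.posDef_W

theorem posSemidef_RR : N.RR.PosSemidef := posSemidef_blockDiag N.posSemidef_R

theorem posDef_Mu : N.Mu.PosDef := posDef_blockDiag fun i => N.posDef_M i

/-- A vector in the kernel of `R` vanishes at the damped nodes. -/
theorem apply_eq_zero_of_damped {x : V × Fin r → ℝ} (hx : N.RR *ᵥ x = 0) {i : V}
    (hi : N.Damped i) (a : Fin r) : x (i, a) = 0 := by
  have h : N.R i *ᵥ (fun b => x (i, b)) = 0 := by
    ext b
    rw [← blockDiag_mulVec_apply]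
    exact congrFun hx (i, b)
  exact congrFun (hi.dotProduct_mulVec_eq_zero (x := fun b => x (i, b)) (by rw [h]; simp)) a

theorem kronecker_one_mulVec_apply {α β : Type*} [Fintype β] (C : Matrix α β ℝ)
    (z : β × Fin r → ℝ) (i : α) (a : Fin r) :
    ((C ⊗ₖ (1 : Matrix (Fin r) (Fin r) ℝ)) *ᵥ z) (i, a) = ∑ k, C i k * z (k, a) := by
  simp [Matrix.mulVec, dotProduct, Fintype.sum_prod_type, Matrix.one_apply]

theorem kronecker_one_transpose_mulVec_apply {α β : Type*} [Fintype α] (C : Matrix α β ℝ)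
    (z : α × Fin r → ℝ) (k : β) (a : Fin r) :
    ((C ⊗ₖ (1 : Matrix (Fin r) (Fin r) ℝ))ᵀ *ᵥ z) (k, a) = ∑ i, C i k * z (i, a) := by
  simp [Matrix.mulVec, dotProduct, Fintype.sum_prod_type, Matrix.one_apply]

theorem BB_transpose_mulVec_apply (x : V × Fin r → ℝ) (k : N.Edge) (a : Fin r) :
    (N.BBᵀ *ᵥ x) (k, a) = x (N.head k, a) - x (N.tail k, a) := by
  rw [BB, kronecker_one_transpose_mulVec_apply]
  simp [incidence, sub_mul, Finset.sum_sub_distrib]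

/-- By connectedness, a vector in the kernel of `𝔹ᵀ` has equal blocks at all nodes. -/
theorem apply_eq_of_BB_transpose_mulVec_eq_zero {x : V × Fin r → ℝ} (hx : N.BBᵀ *ᵥ x = 0)
    (i j : V) (a : Fin r) : x (i, a) = x (j, a) := by
  refine N.connected.eq_of_forall_adj (f := fun i => x (i, a)) (fun i j hij => ?_) i j
  have h : x (N.head ⟨s(i, j), hij⟩, a) - x (N.tail ⟨s(i, j), hij⟩, a) = 0 := by
    rw [← N.BB_transpose_mulVec_apply, hx]
    rfl
  have he := N.ends ⟨s(i, j), hij⟩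
  rcases Sym2.eq_iff.1 he with ⟨ht, hh⟩ | ⟨ht, hh⟩ <;> rw [ht, hh] at h <;> linarith

theorem BB_transpose_mulVec_sync (β : Fin r → ℝ) : N.BBᵀ *ᵥ (syncMatrix V r *ᵥ β) = 0 := by
  ext ⟨k, a⟩
  simp [BB_transpose_mulVec_apply, syncMatrix_mulVec_apply]

theorem dotProduct_LL_mulVec (x : V × Fin r → ℝ) :
    x ⬝ᵥ N.LL *ᵥ x = (N.BBᵀ *ᵥ x) ⬝ᵥ N.WW *ᵥ (N.BBᵀ *ᵥ x) := by
  rw [LL, ← Matrix.mulVec_mulVec, ← Matrix.mulVec_mulVec, Matrix.dotProduct_mulVec,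
    ← Matrix.mulVec_transpose]

theorem dotProduct_LL_mulVec_nonneg (x : V × Fin r → ℝ) : 0 ≤ x ⬝ᵥ N.LL *ᵥ x := by
  rw [dotProduct_LL_mulVec]
  simpa using N.posDef_WW.posSemidef.dotProduct_mulVec_nonneg (N.BBᵀ *ᵥ x)

/-- The kernels of the Laplacian matrix and of `R` meet only in zero, because there is a damped
node. -/
theorem eq_zero_of_dotProduct_LL_mulVec_eq_zero {x : V × Fin r → ℝ} (hL : x ⬝ᵥ N.LL *ᵥ x = 0)
    (hR : N.RR *ᵥ x = 0) : x = 0 := by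
  rw [dotProduct_LL_mulVec] at hL
  obtain ⟨i, hi⟩ := N.exists_damped
  ext ⟨j, a⟩
  rw [N.apply_eq_of_BB_transpose_mulVec_eq_zero (N.posDef_WW.dotProduct_mulVec_eq_zero hL) j i]
  exact N.apply_eq_zero_of_damped hR hi a

/-- The system has an equilibrium with synchronized velocities `β`. -/
theorem exists_equilibrium : ∃ (β : Fin r → ℝ) (q : N.Edge × Fin r → ℝ),
    N.RR *ᵥ (syncMatrix V r *ᵥ β) + (N.BB * N.WW) *ᵥ q = N.v := by
  -- With `K = R (𝟙 ⊗ I)`, the matrix `𝕃 + K Kᵀ` is injective, hence surjective.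
  set K := N.RR * syncMatrix V r with hK
  have hinj : Function.Injective (N.LL + K * Kᵀ).mulVec := by
    rw [← Matrix.coe_mulVecLin, injective_iff_map_eq_zero]
    intro z hz
    rw [Matrix.mulVecLin_apply] at hz
    have hsum : z ⬝ᵥ N.LL *ᵥ z + (Kᵀ *ᵥ z) ⬝ᵥ (Kᵀ *ᵥ z) = 0 := by
      have h := congrArg (z ⬝ᵥ ·) hz
      simp only [dotProduct_zero, Matrix.add_mulVec, dotProduct_add, ← Matrix.mulVec_mulVec] at h
      rwa [Matrix.dotProduct_mulVec z K, ← Matrix.mulVec_transpose] at h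
    have h1 := N.dotProduct_LL_mulVec_nonneg z
    have h2 : 0 ≤ (Kᵀ *ᵥ z) ⬝ᵥ (Kᵀ *ᵥ z) := by
      simpa using dotProduct_star_self_nonneg (Kᵀ *ᵥ z)
    have hL0 : z ⬝ᵥ N.LL *ᵥ z = 0 := by linarith
    have hK0 : Kᵀ *ᵥ z = 0 := dotProduct_self_eq_zero.1 (by linarith)
    refine N.eq_zero_of_dotProduct_LL_mulVec_eq_zero hL0 ?_
    -- The vector `z` is synchronized, so `Kᵀ z = 0` yields `zᵀ R z = 0`.
    obtain ⟨i, -⟩ := N.exists_damped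
    have hB : N.BBᵀ *ᵥ z = 0 := by
      rw [dotProduct_LL_mulVec] at hL0
      exact N.posDef_WW.dotProduct_mulVec_eq_zero hL0
    have hz' : z = syncMatrix V r *ᵥ fun a => z (i, a) := by
      ext ⟨j, a⟩
      rw [syncMatrix_mulVec_apply]
      exact N.apply_eq_of_BB_transpose_mulVec_eq_zero hB j i a
    refine (N.posSemidef_RR.dotProduct_mulVec_zero_iff z).1 ?_
    rw [star_trivial]
    nth_rw 2 [hz']
    rw [Matrix.mulVec_mulVec, ← hK, Matrix.dotProduct_mulVec, ← Matrix.mulVec_transpose, hK0,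
      zero_dotProduct]
  obtain ⟨z, hz⟩ := Matrix.mulVec_surjective_iff_isUnit.2
    (Matrix.mulVec_injective_iff_isUnit.1 hinj) N.v
  refine ⟨Kᵀ *ᵥ z, N.BBᵀ *ᵥ z, ?_⟩
  rw [← hz, Matrix.add_mulVec, LL]
  simp only [hK, Matrix.mulVec_mulVec, Matrix.mul_assoc]
  rw [add_comm]

/-! ### Kron reduction -/

section KronReduction

variable {N} {x : V × Fin r → ℝ}

omit [DecidableEq V] in
theorem sum_Vu_eq {x : V × Fin r → ℝ} (hx : ∀ i a, N.Damped i → x (i, a) = 0) (c : V → ℝ)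
    (a : Fin r) : ∑ j : N.Vu, c j * x (j.1, a) = ∑ j, c j * x (j, a) := by
  rw [← Finset.sum_subtype (Finset.univ.filter fun j => ¬ N.Damped j) (by simp)
    fun j => c j * x (j, a)]
  refine Finset.sum_subset (Finset.filter_subset _ _) fun j _ hj => ?_
  rw [hx j a (by simpa using hj), mul_zero]

omit [DecidableEq V] in
theorem sum_Edge_eq {g : N.Edge → ℝ}
    (hg : ∀ k, N.Damped (N.tail k) → N.Damped (N.head k) → g k = 0) :
    ∑ k, g k = ∑ k : N.Eu, g k.1 + ∑ k : N.Ei, g k.1 := by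
  rw [← Finset.sum_subtype (Finset.univ.filter fun k =>
      ¬ N.Damped (N.tail k) ∧ ¬ N.Damped (N.head k)) (by simp) g,
    ← Finset.sum_subtype (Finset.univ.filter fun k =>
      ¬ (N.Damped (N.tail k) ↔ N.Damped (N.head k))) (by simp) g,
    Finset.sum_filter, Finset.sum_filter, ← Finset.sum_add_distrib]
  refine Finset.sum_congr rfl fun k _ => ?_
  by_cases ht : N.Damped (N.tail k) <;> by_cases hh : N.Damped (N.head k) <;> simp [ht, hh, hg]

omit [Fintype V] in
theorem incidence_eq_zero {i : V} {k : N.Edge} (ht : i ≠ N.tail k) (hh : i ≠ N.head k) :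
    N.incidence i k = 0 := by
  simp [incidence, ht, hh]

theorem Wu_mulVec_apply (hx : ∀ i a, N.Damped i → x (i, a) = 0) (k : N.Eu) (a : Fin r) :
    (N.Wu *ᵥ (N.Buuᵀ *ᵥ fun j => x (j.1.1, j.2))) (k, a) =
      (N.WW *ᵥ (N.BBᵀ *ᵥ x)) (k.1, a) := by
  rw [Wu, WW, blockDiag_mulVec_apply, blockDiag_mulVec_apply]
  congr 2
  ext b
  rw [Buu, BB, kronecker_one_transpose_mulVec_apply, kronecker_one_transpose_mulVec_apply]
  exact sum_Vu_eq hx (fun j => N.incidence j k.1) b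

theorem Wi_mulVec_apply (hx : ∀ i a, N.Damped i → x (i, a) = 0) (k : N.Ei) (a : Fin r) :
    (N.Wi *ᵥ (N.Buiᵀ *ᵥ fun j => x (j.1.1, j.2))) (k, a) =
      (N.WW *ᵥ (N.BBᵀ *ᵥ x)) (k.1, a) := by
  rw [Wi, WW, blockDiag_mulVec_apply, blockDiag_mulVec_apply]
  congr 2
  ext b
  rw [Bui, BB, kronecker_one_transpose_mulVec_apply, kronecker_one_transpose_mulVec_apply]
  exact sum_Vu_eq hx (fun j => N.incidence j k.1) b

/-- The springs between damped nodes exert no force when the damped nodes are at rest. -/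
theorem WW_mulVec_apply_eq_zero (hx : ∀ i a, N.Damped i → x (i, a) = 0) {k : N.Edge}
    (ht : N.Damped (N.tail k)) (hh : N.Damped (N.head k)) (a : Fin r) :
    (N.WW *ᵥ (N.BBᵀ *ᵥ x)) (k, a) = 0 := by
  have h : (fun b => (N.BBᵀ *ᵥ x) (k, b)) = 0 := by
    ext b
    rw [BB_transpose_mulVec_apply, hx _ _ ht, hx _ _ hh, sub_zero, Pi.zero_apply]
  rw [WW, blockDiag_mulVec_apply, h, Matrix.mulVec_zero, Pi.zero_apply]

theorem LL_mulVec_apply (x : V × Fin r → ℝ) (i : V) (a : Fin r) :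
    (N.LL *ᵥ x) (i, a) = ∑ k, N.incidence i k * (N.WW *ᵥ (N.BBᵀ *ᵥ x)) (k, a) := by
  rw [LL, ← Matrix.mulVec_mulVec, ← Matrix.mulVec_mulVec, BB, kronecker_one_mulVec_apply]

theorem LL_mulVec_apply_damped (hx : ∀ i a, N.Damped i → x (i, a) = 0) (i : N.Vd) (a : Fin r) :
    (N.LL *ᵥ x) (i.1, a) = (N.Lii *ᵥ fun j => x (j.1.1, j.2)) (i, a) := by
  rw [LL_mulVec_apply, sum_Edge_eq fun k ht hh => by rw [WW_mulVec_apply_eq_zero hx ht hh, mul_zero],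
    Lii, ← Matrix.mulVec_mulVec, ← Matrix.mulVec_mulVec, Bdi, kronecker_one_mulVec_apply,
    Finset.sum_eq_zero fun k _ => ?_, zero_add]
  · exact Finset.sum_congr rfl fun k _ => by rw [Wi_mulVec_apply hx]; rfl
  · rw [incidence_eq_zero (fun h => k.2.1 (h ▸ i.2)) (fun h => k.2.2 (h ▸ i.2)), zero_mul]

theorem LL_mulVec_apply_undamped (hx : ∀ i a, N.Damped i → x (i, a) = 0) (i : N.Vu) (a : Fin r) :
    (N.LL *ᵥ x) (i.1, a) = ((N.Luu + N.Lui) *ᵥ fun j => x (j.1.1, j.2)) (i, a) := by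
  rw [LL_mulVec_apply, sum_Edge_eq fun k ht hh => by rw [WW_mulVec_apply_eq_zero hx ht hh, mul_zero],
    Matrix.add_mulVec, Pi.add_apply, Luu, Lui, ← Matrix.mulVec_mulVec, ← Matrix.mulVec_mulVec,
    ← Matrix.mulVec_mulVec, ← Matrix.mulVec_mulVec, Bui, Buu, kronecker_one_mulVec_apply,
    kronecker_one_mulVec_apply]
  congr 1
  · exact Finset.sum_congr rfl fun k _ => by rw [← Buu, Wu_mulVec_apply hx]; rfl
  · exact Finset.sum_congr rfl fun k _ => by rw [← Bui, Wi_mulVec_apply hx]; rfl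

theorem kronReduced_mulVec {x : N.Vu × Fin r → ℝ} (hx : N.Lii *ᵥ x = 0) :
    N.kronReduced *ᵥ x = (N.Luu + N.Lui) *ᵥ x := by
  rw [kronReduced, Matrix.sub_mulVec, ← Matrix.mulVec_mulVec, hx, Matrix.mulVec_zero, sub_zero]

/-- A vector supported on the undamped nodes is an eigenvector of `M⁻¹ 𝕃` in the kernel of `R` if
and only if its undamped part is an eigenvector of `M_u⁻¹ 𝕃̃_u` in the kernels of `𝕃_i^i` and of
`R_u`: the rows of the damped nodes say that `𝕃_i^i` annihilates the undamped part, so that the Schur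
complement term of `𝕃̃_u` does not contribute. -/
theorem hasEigenvector_iff_kronReduced (hx : ∀ i a, N.Damped i → x (i, a) = 0) (μ : ℝ) :
    (Module.End.HasEigenvector (Matrix.toLin' (N.MM⁻¹ * N.LL)) μ x ∧ N.RR *ᵥ x = 0) ↔
      (Module.End.HasEigenvector (Matrix.toLin' (N.Mu⁻¹ * N.kronReduced)) μ
        (fun j => x (j.1.1, j.2)) ∧
      N.Lii *ᵥ (fun j => x (j.1.1, j.2)) = 0 ∧ N.Ru *ᵥ (fun j => x (j.1.1, j.2)) = 0) := by
  rw [N.posDef_MM.hasEigenvector_inv_mul_iff, N.posDef_Mu.hasEigenvector_inv_mul_iff]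
  have hrest : ∀ i, N.Damped i → (fun b => x (i, b)) = 0 := fun i hi => funext fun b => hx i b hi
  have hM : ∀ (i : N.Vu) a,
      (N.MM *ᵥ x) (i.1, a) = (N.Mu *ᵥ fun j => x (j.1.1, j.2)) (i, a) := fun i a => by
    rw [MM, Mu, blockDiag_mulVec_apply, blockDiag_mulVec_apply]
  have hMd : ∀ i a, N.Damped i → (N.MM *ᵥ x) (i, a) = 0 := fun i a hi => by
    rw [MM, blockDiag_mulVec_apply, hrest i hi, Matrix.mulVec_zero, Pi.zero_apply]
  have hR : ∀ (i : N.Vu) a,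
      (N.RR *ᵥ x) (i.1, a) = (N.Ru *ᵥ fun j => x (j.1.1, j.2)) (i, a) := fun i a => by
    rw [RR, Ru, blockDiag_mulVec_apply, blockDiag_mulVec_apply]
  have hRd : ∀ i a, N.Damped i → (N.RR *ᵥ x) (i, a) = 0 := fun i a hi => by
    rw [RR, blockDiag_mulVec_apply, hrest i hi, Matrix.mulVec_zero, Pi.zero_apply]
  constructor
  · rintro ⟨⟨hL, hne⟩, hR0⟩
    have hLii : N.Lii *ᵥ (fun j => x (j.1.1, j.2)) = 0 := by
      ext ⟨i, a⟩
      rw [← LL_mulVec_apply_damped hx, hL, Pi.smul_apply, hMd i.1 a i.2, smul_zero, Pi.zero_apply]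
    refine ⟨⟨?_, fun h0 => hne ?_⟩, hLii, ?_⟩
    · ext ⟨i, a⟩
      rw [kronReduced_mulVec hLii, ← LL_mulVec_apply_undamped hx, hL, Pi.smul_apply, hM,
        Pi.smul_apply]
    · ext ⟨i, a⟩
      by_cases hi : N.Damped i
      · exact hx i a hi
      · exact congrFun h0 (⟨i, hi⟩, a)
    · ext ⟨i, a⟩
      rw [← hR, hR0, Pi.zero_apply, Pi.zero_apply]
  · rintro ⟨⟨hL, hne⟩, hLii, hR0⟩
    rw [kronReduced_mulVec hLii] at hL
    refine ⟨⟨?_, fun h0 => hne (by rw [h0]; rfl)⟩, ?_⟩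
    · ext ⟨i, a⟩
      rw [Pi.smul_apply]
      by_cases hi : N.Damped i
      · rw [LL_mulVec_apply_damped hx ⟨i, hi⟩, hLii, hMd i a hi, smul_zero, Pi.zero_apply]
      · rw [LL_mulVec_apply_undamped hx ⟨i, hi⟩, hL, hM ⟨i, hi⟩, Pi.smul_apply]
    · ext ⟨i, a⟩
      by_cases hi : N.Damped i
      · exact hRd i a hi
      · rw [hR ⟨i, hi⟩, hR0, Pi.zero_apply, Pi.zero_apply]

end KronReduction

/-! ### Convergence of the outputs -/

/-- If no eigenvector of `M⁻¹ 𝕃` lies in the kernel of `R`, then every output trajectory tends to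
the synchronized velocity of an equilibrium. -/
theorem tendsto_output_of_forall_hasEigenvector
    (hobs : ∀ (μ : ℝ) (x : V × Fin r → ℝ),
      Module.End.HasEigenvector (Matrix.toLin' (N.MM⁻¹ * N.LL)) μ x → N.RR *ᵥ x ≠ 0)
    {y : ℝ → V × Fin r → ℝ} (hy : N.IsOutputTrajectory y) :
    ∃ β : Fin r → ℝ, Filter.Tendsto y Filter.atTop (𝓝 (syncMatrix V r *ᵥ β)) := by
  obtain ⟨p, q, hpq, hyp⟩ := hy
  obtain ⟨β, q₀, heq⟩ := N.exists_equilibrium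
  refine ⟨β, ?_⟩
  set p₀ := N.MM *ᵥ (syncMatrix V r *ᵥ β) with hp₀
  have hMp₀ : N.MM⁻¹ *ᵥ p₀ = syncMatrix V r *ᵥ β := N.posDef_MM.inv_mulVec_eq_iff.2 hp₀
  have hmom : Filter.Tendsto (fun t => p t - p₀) Filter.atTop (𝓝 0) := by
    refine tendsto_momentum_zero N.BB N.posDef_MM N.posSemidef_RR N.posDef_WW hobs
      (q := fun t => q t - q₀) (fun t ht => ?_) fun t ht => ?_
    · refine ((hpq.deriv_p t ht).sub_const p₀).congr_deriv ?_
      rw [← heq]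
      simp only [Matrix.mulVec_sub, ← Matrix.mulVec_mulVec, hMp₀]
      abel
    · refine ((hpq.deriv_q t ht).sub_const q₀).congr_deriv ?_
      rw [Matrix.mulVec_sub, ← Matrix.mulVec_mulVec p₀, hMp₀, N.BB_transpose_mulVec_sync, sub_zero]
  have hcont : Continuous fun u : V × Fin r → ℝ => N.MM⁻¹ *ᵥ (u + p₀) := by fun_prop
  have h := (hcont.tendsto 0).comp hmom
  rw [zero_add, hMp₀] at h
  refine h.congr fun t => ?_
  rw [Function.comp_apply, sub_add_cancel, hyp]

/-- An eigenvector `x` of `M⁻¹ 𝕃` in the kernel of `R` with eigenvalue `ω²` gives an undamped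
oscillation of the outputs around an equilibrium. -/
theorem isOutputTrajectory_oscillation {β : Fin r → ℝ} {q₀ : N.Edge × Fin r → ℝ}
    (heq : N.RR *ᵥ (syncMatrix V r *ᵥ β) + (N.BB * N.WW) *ᵥ q₀ = N.v) {ω : ℝ} (hω : ω ≠ 0)
    {x : V × Fin r → ℝ} (hL : N.LL *ᵥ x = ω ^ 2 • N.MM *ᵥ x) (hR : N.RR *ᵥ x = 0) :
    N.IsOutputTrajectory fun t => syncMatrix V r *ᵥ β + Real.cos (ω * t) • x := by
  have hinv : ∀ w, N.MM⁻¹ *ᵥ (N.MM *ᵥ w) = w := fun w => N.posDef_MM.inv_mulVec_eq_iff.2 rfl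
  have hlin : ∀ t : ℝ, HasDerivAt (fun s => ω * s) ω t := fun t => by
    simpa using (hasDerivAt_id t).const_mul ω
  refine ⟨fun t => N.MM *ᵥ (syncMatrix V r *ᵥ β + Real.cos (ω * t) • x),
    fun t => q₀ + (Real.sin (ω * t) / ω) • (N.BBᵀ *ᵥ x), ⟨fun t _ => ?_, fun t _ => ?_⟩,
    fun t => (hinv _).symm⟩
  · have h : HasDerivAt (fun s => N.MM *ᵥ (syncMatrix V r *ᵥ β) + Real.cos (ω * s) • (N.MM *ᵥ x))
        ((-Real.sin (ω * t) * ω) • (N.MM *ᵥ x)) t :=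
      ((hlin t).cos.smul_const _).const_add _
    simp only [Matrix.mulVec_add, Matrix.mulVec_smul] at h ⊢
    refine (h.congr_deriv ?_).hasDerivWithinAt
    rw [← heq, Matrix.mulVec_mulVec x (N.BB * N.WW), ← LL, hL]
    simp only [← Matrix.mulVec_mulVec, hinv, hR, smul_zero, add_zero, smul_smul]
    have hsin : Real.sin (ω * t) / ω * ω ^ 2 = Real.sin (ω * t) * ω := by field_simp
    rw [hsin, neg_mul, neg_smul]
    abel
  · have h : HasDerivAt (fun s => q₀ + (Real.sin (ω * s) / ω) • (N.BBᵀ *ᵥ x))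
        ((Real.cos (ω * t) * ω / ω) • (N.BBᵀ *ᵥ x)) t :=
      (((hlin t).sin.div_const ω).smul_const _).const_add _
    refine (h.congr_deriv ?_).hasDerivWithinAt
    rw [← Matrix.mulVec_mulVec, hinv, Matrix.mulVec_add, N.BB_transpose_mulVec_sync, zero_add,
      Matrix.mulVec_smul, mul_div_cancel_right₀ _ hω]

/-- A nonzero oscillation has no limit: it takes its two extreme values at arbitrarily large
times. -/
theorem not_tendsto_oscillation {ι : Type*} {c x l : ι → ℝ} (hx : x ≠ 0) {ω : ℝ} (hω : 0 < ω) :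
    ¬ Filter.Tendsto (fun t => c + Real.cos (ω * t) • x) Filter.atTop (𝓝 l) := by
  intro h
  have hseq : ∀ a : ℝ, Filter.Tendsto (fun k : ℕ => (k * (2 * Real.pi) + a) / ω)
      Filter.atTop Filter.atTop := fun a =>
    ((Filter.tendsto_atTop_add_const_right _ a
      (tendsto_natCast_atTop_atTop.atTop_mul_const Real.two_pi_pos))).atTop_div_const hω
  have hmul : ∀ b : ℝ, ω * (b / ω) = b := fun b => mul_div_cancel₀ b hω.ne'
  have h1 : l = c + (1 : ℝ) • x := by
    refine tendsto_nhds_unique (h.comp (hseq 0)) (tendsto_const_nhds.congr fun k => ?_)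
    simp only [Function.comp_apply, hmul, add_zero, Real.cos_nat_mul_two_pi]
  have h2 : l = c + (-1 : ℝ) • x := by
    refine tendsto_nhds_unique (h.comp (hseq Real.pi)) (tendsto_const_nhds.congr fun k => ?_)
    simp only [Function.comp_apply, hmul, Real.cos_nat_mul_two_pi_add_pi]
  refine hx (funext fun i => ?_)
  have h3 := congrFun (h1.symm.trans h2) i
  simp only [Pi.add_apply, Pi.smul_apply, smul_eq_mul] at h3
  rw [Pi.zero_apply]
  linarith

/-- If every output trajectory converges, then no eigenvector of `M⁻¹ 𝕃` lies in the kernel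
of `R`. -/
theorem RR_mulVec_ne_zero_of_tendsto_output
    (hconv : ∀ y : ℝ → V × Fin r → ℝ, N.IsOutputTrajectory y →
      ∃ l, Filter.Tendsto y Filter.atTop (𝓝 l))
    {μ : ℝ} {x : V × Fin r → ℝ}
    (hx : Module.End.HasEigenvector (Matrix.toLin' (N.MM⁻¹ * N.LL)) μ x) : N.RR *ᵥ x ≠ 0 := by
  intro hR
  obtain ⟨hL, hne⟩ := N.posDef_MM.hasEigenvector_inv_mul_iff.1 hx
  have hμ : 0 < μ := by
    have hM : 0 < x ⬝ᵥ N.MM *ᵥ x := by simpa using N.posDef_MM.dotProduct_mulVec_pos hne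
    have hpos : 0 < x ⬝ᵥ N.LL *ᵥ x := (N.dotProduct_LL_mulVec_nonneg x).lt_of_ne fun h0 =>
      hne (N.eq_zero_of_dotProduct_LL_mulVec_eq_zero h0.symm hR)
    rw [hL, dotProduct_smul, smul_eq_mul] at hpos
    exact pos_of_mul_pos_left hpos hM.le
  obtain ⟨β, q₀, heq⟩ := N.exists_equilibrium
  obtain ⟨l, hl⟩ := hconv _ (N.isOutputTrajectory_oscillation heq (Real.sqrt_pos.2 hμ).ne'
    (by rwa [Real.sq_sqrt hμ.le]) hR)
  exact not_tendsto_oscillation hne (Real.sqrt_pos.2 hμ) hl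

end MSDNetwork

theorem theorem4p8 {V : Type*} [Fintype V] [DecidableEq V] {r : ℕ} (N : MSDNetwork V r) :
    List.TFAE [
      -- every output trajectory converges to a point of the image of `𝟙 ⊗ I_r`
      ∀ y : ℝ → V × Fin r → ℝ, N.IsOutputTrajectory y →
        ∃ β : Fin r → ℝ,
          Filter.Tendsto y Filter.atTop (𝓝 (MSDNetwork.syncMatrix V r *ᵥ β)),
      -- no eigenvector of `M_u⁻¹ 𝕃̃_u` lies in `ker 𝕃_i^i ∩ ker R_u`
      ∀ (μ : ℝ) (x : N.Vu × Fin r → ℝ),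
        Module.End.HasEigenvector (Matrix.toLin' (N.Mu⁻¹ * N.kronReduced)) μ x →
        ¬ (N.Lii *ᵥ x = 0 ∧ N.Ru *ᵥ x = 0),
      -- every eigenvector of `M⁻¹ 𝕃` in `ker R` has a nonzero entry at a damped node
      ∀ (μ : ℝ) (x : V × Fin r → ℝ),
        Module.End.HasEigenvector (Matrix.toLin' (N.MM⁻¹ * N.LL)) μ x →
        N.RR *ᵥ x = 0 →
        ∃ (i : V) (a : Fin r), N.Damped i ∧ x (i, a) ≠ 0] := by
  tfae_have 1 → 3 := fun h μ x hx hR =>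
    absurd hR (N.RR_mulVec_ne_zero_of_tendsto_output
      (fun y hy => (h y hy).imp' _ fun _ hβ => hβ) hx)
  tfae_have 3 → 1 := fun h y hy => by
    refine N.tendsto_output_of_forall_hasEigenvector (fun μ x hx hR => ?_) hy
    obtain ⟨i, a, hi, hne⟩ := h μ x hx hR
    exact hne (N.apply_eq_zero_of_damped hR hi a)
  tfae_have 2 → 3 := fun h μ x hx hR =>
    absurd ((MSDNetwork.hasEigenvector_iff_kronReduced
      (fun i a hi => N.apply_eq_zero_of_damped hR hi a) μ).1 ⟨hx, hR⟩) fun hu => h μ _ hu.1 hu.2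
  tfae_have 3 → 2 := fun h μ x hx hker => by
    -- Extend the eigenvector by zero to the damped nodes.
    let z : V × Fin r → ℝ := fun j => if hj : N.Damped j.1 then 0 else x (⟨j.1, hj⟩, j.2)
    have hz : ∀ i a, N.Damped i → z (i, a) = 0 := fun i a hi => dif_pos hi
    have hzx : (fun j : N.Vu × Fin r => z (j.1.1, j.2)) = x := funext fun j => dif_neg j.1.2
    obtain ⟨hzL, hzR⟩ := (MSDNetwork.hasEigenvector_iff_kronReduced hz μ).2 (by
      rw [hzx]
      exact ⟨hx, hker⟩)
    obtain ⟨i, a, hi, hne⟩ := h μ z hzL hzR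
    exact hne (hz i a hi)
  tfae_finish
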